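/- Consider a Boolean control network $x_i(t+1)=f_i(x_1(t),\dots,x_n(t);u_1(t),\dots,u_m(t))$, $i=1,\dots,n$, with $x_i,u_i\in\{0,1\}$ and Boolean functions $f_i$. Put $N=2^n$, $M=2^m$, and let $\delta_k^i$ be the $i$-th column of the $k\times k$ identity matrix. Identify the values $1,0$ with $\delta_2^1,\delta_2^2$, a state $(x_1,\dots,x_n)$ with $x_1\otimes\cdots\otimes x_n\in\{\delta_N^1,\dots,\delta_N^N\}$, and an input with a vector $\delta_M^r$ in the same way. Let $L$ be the $N\times NM$ structure matrix, so that $x(t+1)=L\ltimes u(t)\ltimes x(t)$ ($\ltimes$ is the semi-tensor product). Let $\mathcal M$ be the Boolean sum of the matrices $L\ltimes\delta_M^r$, $1\le r\le M$, and let $\mathcal F$ be the Boolean sum of the Boolean powers $\mathcal M^{(1)},\dots,\mathcal M^{(N)}$. For states $\delta_N^i,\delta_N^j$ let $\rho(i,j)$ be the set of integers $k\ge1$ such that some control sequence $u(0),\dots,u(k-1)$ steers the network from $x(0)=\delta_N^i$ to $x(k)=\delta_N^j$, and let $\sigma(i,j)=\mathbb Z^+\setminus\rho(i,j)$. Put -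 $\mathcal C_{ji}=0$ (unreachable) if $\rho(i,j)=\emptyset$; - $\mathcal C_{ji}=1$ (transient) if $0<|\rho(i,j)|<\infty$ and $|\sigma(i,j)|=\infty$; - $\mathcal C_{ji}=2$ (primitive) if $|\rho(i,j)|=\infty$ and $|\sigma(i,j)|<\infty$; - $\mathcal C_{ji}=3$ (imprimitive) if $|\rho(i,j)|=|\sigma(i,j)|=\infty$. Let $G$ be the state transition digraph: its nodes are the states, with an edge $\delta_N^i\to\delta_N^j$ if $\delta_N^j=L\ltimes u\ltimes\delta_N^i$ for some input $u$. Paths have pairwise distinct nodes (a single node is a path of length $0$). The strongly connected components (SCCs) of $G$ are the nodes of its condensation digraph, which has an edge $\alpha\to\beta$, $\alpha\ne\beta$, if $G$ has an edge from a node of $\alpha$ to a node of $\beta$. An SCC is trivial if it is a single node without a self-loop; the index of imprimitivity of a nontrivial SCC is the gcd of the lengths of its cycles (self-loops included). Fix $i,j$ and let $p^{*1},\dots,p^{*K}$ ($K\ge0$) be all paths in the condensation digraph from the SCC of $\delta_N^i$ to the SCC of $\delta_N^j$. Let $P_{ij}^k$ be the set of paths in $G$ from $\delta_N^i$ to $\delta_N^j$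 that become $p^{*k}$ when each node is replaced by its SCC and consecutive repetitions are deleted. If $p^{*k}$ contains no nontrivial SCC, put $\eta_{ij}^k=0$ and $\pi_{ij}^k=\tilde\pi_{ij}^k=\emptyset$. Otherwise let $\eta_{ij}^k$ be the gcd of the indices of imprimitivity of the nontrivial SCCs on $p^{*k}$, and $\pi_{ij}^k=\{\,l(p)\bmod\eta_{ij}^k : p\in P_{ij}^k\,\}$, where $l(p)$ is the length of $p$. Let $\bar\eta_{ij}$ be the least common multiple of the nonzero numbers among $\eta_{ij}^1,\dots,\eta_{ij}^K$ (with $\bar\eta_{ij}=1$ if there are none); for $\eta_{ij}^k\ne0$ let $\tilde\pi_{ij}^k=\{\,a+b\,\eta_{ij}^k : a\in\pi_{ij}^k,\ 0\le b\le\bar\eta_{ij}/\eta_{ij}^k-1\,\}$; and let $\bar\pi_{ij}=\bigcup_{k=1}^K\tilde\pi_{ij}^k$. Then for all $i,j\in\{1,\dots,N\}$: 1. $\mathcal C_{ji}=0$ if and only if $\mathcal F_{ji}=0$; 2. $\mathcal C_{ji}=1$ if and only if $\bar\pi_{ij}=\emptyset$ and $\mathcal F_{ji}=1$; 3. $\mathcal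 C_{ji}=2$ if and only if $\bar\pi_{ij}=\{0,1,\dots,\bar\eta_{ij}-1\}$; 4. $\mathcal C_{ji}=3$ if and only if $\bar\pi_{ij}\ne\emptyset$ and $\bar\pi_{ij}\ne\{0,1,\dots,\bar\eta_{ij}-1\}$. -/

import Mathlib

/-! ### Digraphs: walks, paths, cycles -/

namespace Digraph

/-- The list `l = [v₀, v₁, …, v_r]` is a walk `v₀ → v₁ → ⋯ → v_r` of `G` with `v₀ = a`, `v_r = b`. -/
def IsWalk {V : Type*} (G : Digraph V) (a b : V) (l : List V) : Prop :=
  l.IsChain G.Adj ∧ l.head? = some a ∧ l.getLast? = some b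

/-- The number of edges of a walk that is given by its (non-empty) list of nodes. -/
def walkLength {V : Type*} (l : List V) : ℕ := l.length - 1

/-- A path is a walk whose nodes are pairwise distinct. -/
def IsPath {V : Type*} (G : Digraph V) (a b : V) (l : List V) : Prop :=
  G.IsWalk a b l ∧ l.Nodup

/-- A cycle is a closed walk of positive length in which no node is repeated, except that the
starting node and the ending node coincide. A self-loop `v → v` is a cycle of length 1. -/
def IsCycle {V : Type*} (G : Digraph V) (v : V) (l : List V) : Prop :=
  G.IsWalk v v l ∧ 1 ≤ walkLength l ∧ l.tail.Nodup

/-- The index of imprimitivity: the greatest common divisor of the lengths of the cycles. -/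
noncomputable def imprimitivityIndex {V : Type*} (G : Digraph V) : ℕ :=
  Nat.setGcd {r | ∃ v l, G.IsCycle v l ∧ walkLength l = r}

/-! ### Strongly connected components and the condensation digraph -/

/-- There is a directed walk (possibly of length 0) from `a` to `b`. -/
def Reaches {V : Type*} (G : Digraph V) (a b : V) : Prop :=
  ∃ l, G.IsWalk a b l

theorem reaches_iff_reflTransGen {V : Type*} (G : Digraph V) (a b : V) :
    G.Reaches a b ↔ Relation.ReflTransGen G.Adj a b := by
  constructor
  · rintro ⟨l, hc, hh, hl⟩
    induction l generalizing a with
    | nil => simp at hh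
    | cons x t ih =>
      simp only [List.head?_cons, Option.some.injEq] at hh
      subst hh
      cases t with
      | nil =>
        simp only [List.getLast?_singleton, Option.some.injEq] at hl
        subst hl
        exact Relation.ReflTransGen.refl
      | cons y s =>
        rw [List.isChain_cons_cons] at hc
        exact Relation.ReflTransGen.head hc.1
          (ih y hc.2 rfl (by simpa [List.getLast?_cons_cons] using hl))
  · intro h
    induction h using Relation.ReflTransGen.head_induction_on with
    | refl => exact ⟨[b], by simp [IsWalk]⟩
    | @head x y hac _ ih =>
      obtain ⟨l, hc, hh, hl⟩ := ih
      cases l with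
      | nil => simp at hh
      | cons z t =>
        simp only [List.head?_cons, Option.some.injEq] at hh
        subst hh
        exact ⟨x :: z :: t, List.isChain_cons_cons.2 ⟨hac, hc⟩, rfl,
          by simpa [List.getLast?_cons_cons] using hl⟩

/-- Strong connectivity of two nodes, as an equivalence relation. -/
def sccSetoid {V : Type*} (G : Digraph V) : Setoid V where
  r a b := G.Reaches a b ∧ G.Reaches b a
  iseqv := by
    simp only [reaches_iff_reflTransGen]
    exact ⟨fun _ => ⟨.refl, .refl⟩, fun h => ⟨h.2, h.1⟩,
      fun h k => ⟨h.1.trans k.1, k.2.trans h.2⟩⟩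

/-- The type of strongly connected components of `G`. -/
def SCC {V : Type*} (G : Digraph V) : Type _ := Quotient G.sccSetoid

/-- The strongly connected component that a node belongs to. -/
def sccId {V : Type*} (G : Digraph V) (v : V) : G.SCC := Quotient.mk G.sccSetoid v

/-- The subgraph of `G` induced on the nodes of a strongly connected component. -/
def sccGraph {V : Type*} (G : Digraph V) (α : G.SCC) : Digraph {v : V // G.sccId v = α} where
  Adj u v := G.Adj u.1 v.1

/-- A trivial component: a single node without a self-loop. -/
def IsTrivialSCC {V : Type*} (G : Digraph V) (α : G.SCC) : Prop :=
  ∃ v, (∀ w, G.sccId w = α ↔ w = v) ∧ ¬ G.Adj v v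

/-- The condensation digraph: its nodes are the strongly connected components, with an edge from
`α` to a different component `β` if some edge of `G` leads from a node of `α` to a node of `β`.
(It has no self-loops, hence no closed walks of positive length.) -/
def condensation {V : Type*} (G : Digraph V) : Digraph G.SCC where
  Adj α β := α ≠ β ∧ ∃ u v, G.sccId u = α ∧ G.sccId v = β ∧ G.Adj u v

/-! ### Residues of path lengths, grouped by condensation paths

Below, `p` is a path from the component of `i` to the component of `j` in the condensation. -/

/-- The condensation paths from the component of `i` to the component of `j`. -/
def condPaths {V : Type*} (G : Digraph V) (i j : V) : Set (List G.SCC) :=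
  {p | G.condensation.IsPath (G.sccId i) (G.sccId j) p}

open Classical in
/-- The paths from `i` to `j` that follow `p`: replacing every node by its component and deleting
repetitions of consecutive components gives `p`. -/
def pathClass {V : Type*} (G : Digraph V) (i j : V) (p : List G.SCC) : Set (List V) :=
  {l | G.IsPath i j l ∧ (l.map G.sccId).destutter (· ≠ ·) = p}

/-- The gcd of the indices of imprimitivity of the nontrivial components along `p`; it is `0` if
there is no nontrivial component along `p`. -/
noncomputable def eta {V : Type*} (G : Digraph V) (p : List G.SCC) : ℕ :=
  Nat.setGcd {d | ∃ α ∈ p, ¬ G.IsTrivialSCC α ∧ (G.sccGraph α).imprimitivityIndex = d}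

/-- The residues modulo `eta p` of the lengths of the paths from `i` to `j` that follow `p`; empty
if there is no nontrivial component along `p`. -/
def residues {V : Type*} (G : Digraph V) (i j : V) (p : List G.SCC) : Set ℕ :=
  {a | (∃ α ∈ p, ¬ G.IsTrivialSCC α) ∧ ∃ l ∈ G.pathClass i j p, walkLength l % G.eta p = a}

/-- The least common multiple of the nonzero numbers among the `eta p`, where `p` runs over all
condensation paths from the component of `i` to that of `j` (it is `1` if there are none). -/
noncomputable def etaBar {V : Type*} (G : Digraph V) (i j : V) : ℕ :=
  sInf {N | 0 < N ∧ ∀ p ∈ G.condPaths i j, G.eta p ≠ 0 → G.eta p ∣ N}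

/-- The residues attached to `p`, lifted to residues modulo `etaBar i j`. -/
def liftedResidues {V : Type*} (G : Digraph V) (i j : V) (p : List G.SCC) : Set ℕ :=
  {c | ∃ a ∈ G.residues i j p, ∃ b < G.etaBar i j / G.eta p, a + b * G.eta p = c}

/-- The union of the lifted residues over all condensation paths. -/
def piBar {V : Type*} (G : Digraph V) (i j : V) : Set ℕ :=
  ⋃ p ∈ G.condPaths i j, G.liftedResidues i j p

end Digraph

/-! ### Boolean matrices -/

namespace BoolMat

/-- The Boolean product: the `(i, j)` entry is the disjunction over `k` of `A i k ∧ B k j`. -/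
def mul {ι κ τ : Type*} [Fintype κ] (A : Matrix ι κ Bool) (B : Matrix κ τ Bool) :
    Matrix ι τ Bool :=
  fun i j => decide (∃ k, A i k = true ∧ B k j = true)

/-- The Boolean power `A^(k)`. -/
def pow {ι : Type*} [Fintype ι] [DecidableEq ι] (A : Matrix ι ι Bool) : ℕ → Matrix ι ι Bool
  | 0 => fun i j => decide (i = j)
  | k + 1 => mul (pow A k) A

/-- The logical vector `δ_k^i`, the `i`-th column of the identity matrix. -/
def delta {k : ℕ} (i : Fin k) : Fin k → Bool := fun a => decide (a = i)

/-- The semi-tensor product `L ⋉ u = L (u ⊗ I_N)` of a matrix with `M N` columns and a vector of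
length `M`. The columns of `L` are numbered by pairs in lexicographic order. -/
def stp {ι : Type*} {M N : ℕ} (L : Matrix ι (Fin M × Fin N) Bool) (u : Fin M → Bool) :
    Matrix ι (Fin N) Bool :=
  mul L fun c s => u c.1 && decide (c.2 = s)

/-- The Boolean matrix-vector product. -/
def mulVec {ι κ : Type*} [Fintype κ] (A : Matrix ι κ Bool) (x : κ → Bool) : ι → Bool :=
  fun i => decide (∃ k, A i k = true ∧ x k = true)

/-- The position of the entry 1 in the logical vector `⋉_l x_l` (an iterated Kronecker product),
where the value 1 (`true`) of a variable stands for `δ_2^1` and the value 0 (`false`) for `δ_2^2`.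
Positions are counted from 0. -/
def vecIndex (k : ℕ) : (Fin k → Bool) ≃ Fin (2 ^ k) :=
  ((Equiv.arrowCongr Fin.revPerm (Equiv.boolNot.trans finTwoEquiv.symm))).trans finFunctionFinEquiv

theorem vecIndex_val (k : ℕ) (x : Fin k → Bool) :
    (vecIndex k x : ℕ) = ∑ l : Fin k, (if x l then 0 else 2 ^ (k - 1 - (l : ℕ))) := by
  simp only [vecIndex, Equiv.trans_apply, finFunctionFinEquiv_apply]
  rw [← Equiv.sum_comp Fin.revPerm]
  refine Finset.sum_congr rfl fun l _ => ?_
  have h : k - (l.val + 1) = k - 1 - l.val := by omega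
  cases hx : x l <;> simp [Equiv.arrowCongr, hx, finTwoEquiv, h]

end BoolMat

/-! ### Boolean control networks -/

/-- A Boolean control network with `n` state variables and `m` input variables:
`x_i(t+1) = f_i(x_1(t), …, x_n(t); u_1(t), …, u_m(t))`. -/
structure BCN (n m : ℕ) where
  /-- The logical functions. -/
  f : Fin n → (Fin n → Bool) → (Fin m → Bool) → Bool

namespace BCN

/-- The state after one step from `x` under the input `u`. -/
def step {n m : ℕ} (B : BCN n m) (x : Fin n → Bool) (u : Fin m → Bool) : Fin n → Bool :=
  fun i => B.f i x u

/-- The trajectory from `x₀` under the control sequence `u(0), u(1), …`. -/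
def trajectory {n m : ℕ} (B : BCN n m) (x₀ : Fin n → Bool) (u : ℕ → Fin m → Bool) :
    ℕ → Fin n → Bool
  | 0 => x₀
  | t + 1 => B.step (B.trajectory x₀ u t) (u t)

/-- The state whose vector form is `δ_N^i`, `N = 2^n`. -/
def state {n : ℕ} (i : Fin (2 ^ n)) : Fin n → Bool := (BoolMat.vecIndex n).symm i

/-- The set of reachable time steps: the positive `k` for which some control sequence steers the
network from `x(0) = δ_N^i` to `x(k) = δ_N^j`. -/
def reachTimes {n m : ℕ} (B : BCN n m) (i j : Fin (2 ^ n)) : Set ℕ :=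
  {k | 0 < k ∧ ∃ u : ℕ → Fin m → Bool, B.trajectory (state i) u k = state j}

/-- The set of unreachable time steps. -/
def unreachTimes {n m : ℕ} (B : BCN n m) (i j : Fin (2 ^ n)) : Set ℕ :=
  {k | 0 < k ∧ k ∉ B.reachTimes i j}

/-- The ordered pair `(δ_N^i, δ_N^j)` is unreachable. -/
def IsUnreachable {n m : ℕ} (B : BCN n m) (i j : Fin (2 ^ n)) : Prop :=
  B.reachTimes i j = ∅

/-- The ordered pair `(δ_N^i, δ_N^j)` is transient. -/
def IsTransient {n m : ℕ} (B : BCN n m) (i j : Fin (2 ^ n)) : Prop :=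
  (B.reachTimes i j).Nonempty ∧ (B.reachTimes i j).Finite ∧ (B.unreachTimes i j).Infinite

/-- The ordered pair `(δ_N^i, δ_N^j)` is primitive. -/
def IsPrimitive {n m : ℕ} (B : BCN n m) (i j : Fin (2 ^ n)) : Prop :=
  (B.reachTimes i j).Infinite ∧ (B.unreachTimes i j).Finite

/-- The ordered pair `(δ_N^i, δ_N^j)` is imprimitive. -/
def IsImprimitive {n m : ℕ} (B : BCN n m) (i j : Fin (2 ^ n)) : Prop :=
  (B.reachTimes i j).Infinite ∧ (B.unreachTimes i j).Infinite

open Classical in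
/-- The controllability categorization matrix; the entry `(j, i)` is the category of the ordered
pair `(δ_N^i, δ_N^j)`. -/
noncomputable def categoryMatrix {n m : ℕ} (B : BCN n m) :
    Matrix (Fin (2 ^ n)) (Fin (2 ^ n)) (Fin 4) :=
  fun j i => if B.IsUnreachable i j then 0 else if B.IsTransient i j then 1
    else if B.IsPrimitive i j then 2 else 3

/-- Every ordered pair lies in exactly the category that `categoryMatrix` says. -/
theorem categoryMatrix_eq_iff {n m : ℕ} (B : BCN n m) (i j : Fin (2 ^ n)) :
    (B.categoryMatrix j i = 0 ↔ B.IsUnreachable i j) ∧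
    (B.categoryMatrix j i = 1 ↔ B.IsTransient i j) ∧
    (B.categoryMatrix j i = 2 ↔ B.IsPrimitive i j) ∧
    (B.categoryMatrix j i = 3 ↔ B.IsImprimitive i j) := by
  have key : (B.reachTimes i j).Finite → (B.unreachTimes i j).Infinite := by
    intro h1 h2
    refine Set.Ioi_infinite (0 : ℕ) ((h1.union h2).subset fun k hk => ?_)
    by_cases hm : k ∈ B.reachTimes i j
    · exact Or.inl hm
    · exact Or.inr ⟨hk, hm⟩
  have h0 : B.reachTimes i j = ∅ → (B.reachTimes i j).Finite := fun h => h ▸ Set.finite_empty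
  have hne := Set.nonempty_iff_ne_empty (s := B.reachTimes i j)
  unfold categoryMatrix IsUnreachable IsTransient IsPrimitive IsImprimitive
  unfold Set.Infinite at *
  by_cases h1 : B.reachTimes i j = ∅ <;> by_cases h2 : (B.reachTimes i j).Finite <;>
    by_cases h3 : (B.unreachTimes i j).Finite <;> simp_all

/-- The structure matrix `L` (of size `N × NM`) of the algebraic form `x(t+1) = L ⋉ u(t) ⋉ x(t)`:
its column number `(r, s)` is the vector form of the successor of `δ_N^s` under the input
`δ_M^r`. -/
def structureMatrix {n m : ℕ} (B : BCN n m) :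
    Matrix (Fin (2 ^ n)) (Fin (2 ^ m) × Fin (2 ^ n)) Bool :=
  fun a c => BoolMat.delta (BoolMat.vecIndex n (B.step (state c.2) ((BoolMat.vecIndex m).symm c.1))) a

/-- The algebraic form of the network. -/
theorem structureMatrix_spec {n m : ℕ} (B : BCN n m) (x : Fin n → Bool) (u : Fin m → Bool) :
    BoolMat.mulVec (BoolMat.stp B.structureMatrix (BoolMat.delta (BoolMat.vecIndex m u)))
      (BoolMat.delta (BoolMat.vecIndex n x)) =
    BoolMat.delta (BoolMat.vecIndex n (B.step x u)) := by
  funext a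
  rw [Bool.eq_iff_iff]
  simp only [BoolMat.mulVec, BoolMat.stp, BoolMat.mul, BoolMat.delta, structureMatrix, state,
    Bool.and_eq_true, decide_eq_true_eq]
  constructor
  · rintro ⟨k, ⟨⟨r, s⟩, h1, h2, h3⟩, h4⟩
    simp only at h1 h2 h3
    subst h2 h3 h4
    simpa using h1
  · intro h
    exact ⟨_, ⟨(_, _), by simpa using h, rfl, rfl⟩, rfl⟩

/-- The matrix `𝓜`, the Boolean sum of the matrices `L ⋉ δ_M^r` over all inputs `δ_M^r`. -/
def oneStepMatrix {n m : ℕ} (B : BCN n m) : Matrix (Fin (2 ^ n)) (Fin (2 ^ n)) Bool :=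
  fun j i => decide (∃ r : Fin (2 ^ m),
    BoolMat.stp B.structureMatrix (BoolMat.delta r) j i = true)

/-- The controllability matrix `𝓕`, the Boolean sum of the Boolean powers `𝓜^(1), …, 𝓜^(N)`. -/
def controllabilityMatrix {n m : ℕ} (B : BCN n m) : Matrix (Fin (2 ^ n)) (Fin (2 ^ n)) Bool :=
  fun j i => decide (∃ k : Fin (2 ^ n), BoolMat.pow B.oneStepMatrix ((k : ℕ) + 1) j i = true)

/-- The state transition digraph, with `δ_N^i` represented by `i`: there is an edge from `δ_N^i`
to `δ_N^j` if `δ_N^j = L ⋉ u ⋉ δ_N^i` for some input `u`. -/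
def stateDigraph {n m : ℕ} (B : BCN n m) : Digraph (Fin (2 ^ n)) where
  Adj i j := ∃ r : Fin (2 ^ m), BoolMat.delta j =
    BoolMat.mulVec (BoolMat.stp B.structureMatrix (BoolMat.delta r)) (BoolMat.delta i)

end BCN

/-! Control sequences of length `k` from `i` to `j` correspond to walks of length `k` in the state
digraph, so all four categories depend only on the set of walk lengths. The core is
`eventually_hasWalk_iff`: for large `k`, a walk of length `k` exists exactly when `k` mod `etaBar`
lies in `piBar`. Hence the reachable times are infinite iff `piBar` is nonempty, and the unreachable
times are infinite iff `piBar` misses some residue.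

For necessity, a walk is cut down to a path by removing closed walks (`IsWalk.exists_isPath`). Each
of these stays in one component, so the total length removed is a multiple of `eta`, and the path
still meets the same components. A long walk repeats a node, hence meets a nontrivial component.

For sufficiency, closed walks are inserted at nodes of a path (`IsWalk.exists_insert`). Their
lengths generate a submonoid of ℕ that contains all large multiples of its gcd. This gcd is `eta`
(`eta_eq_setGcd`), because the index of a component is the gcd of the closed walk lengths at any one
of its nodes (`imprimitivityIndex_sccGraph`). -/

theorem List.exists_append_of_not_nodup {α : Type*} {l : List α} (h : ¬ l.Nodup) :
    ∃ s x t u, l = s ++ x :: (t ++ x :: u) := by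
  induction l with
  | nil => simp at h
  | cons y l ih =>
    by_cases hy : y ∈ l
    · obtain ⟨t, u, rfl⟩ := List.append_of_mem hy
      exact ⟨[], y, t, u, rfl⟩
    · obtain ⟨s, x, t, u, rfl⟩ := ih fun hl => h (List.nodup_cons.2 ⟨hy, hl⟩)
      exact ⟨y :: s, x, t, u, rfl⟩

/-! ### Walks of prescribed length -/

namespace Digraph

variable {V : Type*} {G : Digraph V}

theorem IsWalk.ne_nil {a b : V} {l : List V} (h : G.IsWalk a b l) : l ≠ [] := by
  rintro rfl
  simpa using h.2.1

theorem isWalk_append_cons {a b v : V} {s u : List V} :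
    G.IsWalk a b (s ++ v :: u) ↔ G.IsWalk a v (s ++ [v]) ∧ G.IsWalk v b (v :: u) := by
  unfold IsWalk
  rw [List.isChain_split]
  cases s <;> simp [List.getLast?_cons] <;> tauto

theorem isWalk_singleton (a : V) : G.IsWalk a a [a] := by simp [IsWalk]

theorem IsWalk.exists_eq_cons {a b : V} {l : List V} (h : G.IsWalk a b l) :
    ∃ t, l = a :: t := by
  cases l with
  | nil => exact absurd rfl h.ne_nil
  | cons x t => exact ⟨t, by simpa using h.2.1⟩

theorem IsWalk.exists_eq_concat {a b : V} {l : List V} (h : G.IsWalk a b l) :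
    ∃ t, l = t ++ [b] := by
  have := h.2.2
  rw [List.getLast?_eq_some_iff] at this
  exact this

/-- The inclusions let further closed walks be inserted at the old nodes later on. -/
theorem IsWalk.append {a b c : V} {p q : List V} (hp : G.IsWalk a b p) (hq : G.IsWalk b c q) :
    ∃ l, G.IsWalk a c l ∧ walkLength l = walkLength p + walkLength q ∧ p ⊆ l ∧ q ⊆ l := by
  obtain ⟨s, rfl⟩ := hp.exists_eq_concat
  obtain ⟨t, rfl⟩ := hq.exists_eq_cons
  refine ⟨s ++ b :: t, isWalk_append_cons.2 ⟨hp, hq⟩, ?_, ?_, ?_⟩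
  · simp [walkLength]
  · intro x; simp; tauto
  · intro x; simp; tauto

/-- There is a walk of length `k` from `a` to `b`. -/
def HasWalk (G : Digraph V) (k : ℕ) (a b : V) : Prop :=
  ∃ l, G.IsWalk a b l ∧ walkLength l = k

theorem HasWalk.add {a b c : V} {k r : ℕ} (h : G.HasWalk k a b) (h' : G.HasWalk r b c) :
    G.HasWalk (k + r) a c := by
  obtain ⟨p, hp, rfl⟩ := h
  obtain ⟨q, hq, rfl⟩ := h'
  obtain ⟨l, hl, hlen, -⟩ := hp.append hq
  exact ⟨l, hl, hlen⟩

theorem hasWalk_zero {a b : V} : G.HasWalk 0 a b ↔ a = b := by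
  constructor
  · rintro ⟨l, hl, h0⟩
    obtain ⟨t, rfl⟩ := hl.exists_eq_cons
    have : t = [] := by simpa [walkLength] using h0
    subst this
    simpa using hl.2.2
  · rintro rfl
    exact ⟨[a], isWalk_singleton a, rfl⟩

theorem hasWalk_one {a b : V} : G.HasWalk 1 a b ↔ G.Adj a b := by
  constructor
  · rintro ⟨l, hl, h0⟩
    obtain ⟨t, rfl⟩ := hl.exists_eq_cons
    have : t.length = 1 := by simpa [walkLength] using h0
    obtain ⟨x, rfl⟩ := List.length_eq_one_iff.1 this
    have h1 : x = b := by simpa using hl.2.2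
    subst h1
    simpa using hl.1
  · intro h
    exact ⟨[a, b], by simp [IsWalk, h], rfl⟩

theorem hasWalk_succ {a b : V} {k : ℕ} :
    G.HasWalk (k + 1) a b ↔ ∃ c, G.Adj a c ∧ G.HasWalk k c b := by
  constructor
  · rintro ⟨l, hl, h0⟩
    obtain ⟨t, rfl⟩ := hl.exists_eq_cons
    cases t with
    | nil => simp [walkLength] at h0
    | cons x t =>
      have h1 := (isWalk_append_cons (s := [a])).1 hl
      refine ⟨x, hasWalk_one.1 ⟨_, h1.1, rfl⟩, _, h1.2, ?_⟩
      simpa [walkLength] using h0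
  · rintro ⟨c, h1, h2⟩
    rw [add_comm]
    exact (hasWalk_one.2 h1).add h2

theorem hasWalk_succ' {a b : V} {k : ℕ} :
    G.HasWalk (k + 1) a b ↔ ∃ c, G.HasWalk k a c ∧ G.Adj c b := by
  induction k generalizing a with
  | zero => simp [hasWalk_one, hasWalk_zero]
  | succ k ih =>
    rw [hasWalk_succ]
    constructor
    · rintro ⟨c, hc, h⟩
      obtain ⟨d, hd, h⟩ := ih.1 h
      exact ⟨d, hasWalk_succ.2 ⟨c, hc, hd⟩, h⟩
    · rintro ⟨d, hd, h⟩
      obtain ⟨c, hc, hd⟩ := hasWalk_succ.1 hd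
      exact ⟨c, hc, ih.2 ⟨d, hd, h⟩⟩

theorem reaches_iff_exists_hasWalk {a b : V} : G.Reaches a b ↔ ∃ k, G.HasWalk k a b :=
  ⟨fun ⟨l, hl⟩ => ⟨_, l, hl, rfl⟩, fun ⟨_, l, hl, _⟩ => ⟨l, hl⟩⟩

theorem HasWalk.reaches {a b : V} {k : ℕ} (h : G.HasWalk k a b) : G.Reaches a b :=
  reaches_iff_exists_hasWalk.2 ⟨k, h⟩

theorem Reaches.trans {a b c : V} (h : G.Reaches a b) (h' : G.Reaches b c) : G.Reaches a c := by
  rw [reaches_iff_reflTransGen] at *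
  exact h.trans h'

theorem Reaches.of_adj {a b : V} (h : G.Adj a b) : G.Reaches a b := (hasWalk_one.2 h).reaches

theorem sccId_eq_iff {a b : V} : G.sccId a = G.sccId b ↔ G.Reaches a b ∧ G.Reaches b a :=
  Quotient.eq (r := G.sccSetoid)

/-- Removing a closed walk from a walk with a repeated node. -/
theorem IsWalk.exists_shortcut {a b : V} {s t u : List V} {x : V}
    (h : G.IsWalk a b (s ++ x :: (t ++ x :: u))) :
    G.IsWalk a b (s ++ x :: u) ∧ G.IsWalk x x (x :: (t ++ [x])) := by
  obtain ⟨h1, h2⟩ := isWalk_append_cons.1 h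
  obtain ⟨h2, h3⟩ := (isWalk_append_cons (s := x :: t)).1 h2
  exact ⟨isWalk_append_cons.2 ⟨h1, h3⟩, h2⟩

theorem IsWalk.reaches_of_mem {a b x : V} {l : List V} (h : G.IsWalk a b l) (hx : x ∈ l) :
    G.Reaches a x ∧ G.Reaches x b := by
  obtain ⟨s, t, rfl⟩ := List.append_of_mem hx
  exact ⟨⟨_, (isWalk_append_cons.1 h).1⟩, ⟨_, (isWalk_append_cons.1 h).2⟩⟩

theorem IsWalk.sccId_eq_of_mem {a x : V} {l : List V} (h : G.IsWalk a a l) (hx : x ∈ l) :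
    G.sccId x = G.sccId a :=
  sccId_eq_iff.2 (h.reaches_of_mem hx).symm

/-- A shortest walk of positive length visits no node twice after its start. -/
theorem HasWalk.exists_le_card [Fintype V] {a b : V} {k : ℕ} (h : G.HasWalk k a b) (hk : 0 < k) :
    ∃ r, 0 < r ∧ r ≤ Fintype.card V ∧ G.HasWalk r a b := by
  induction k using Nat.strong_induction_on with
  | _ k ih =>
    obtain ⟨l, hl, rfl⟩ := h
    obtain ⟨t, rfl⟩ := hl.exists_eq_cons
    by_cases ht : t.Nodup
    · exact ⟨_, hk, by simpa [walkLength] using ht.length_le_card, _, hl, rfl⟩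
    · obtain ⟨s, x, t, u, rfl⟩ := List.exists_append_of_not_nodup ht
      have h1 := (IsWalk.exists_shortcut (s := a :: s) hl).1
      exact ih _ (by simp [walkLength]) ⟨_, h1, rfl⟩ (by simp [walkLength])

/-! ### The index of imprimitivity and closed walks -/

/-- The lengths of the closed walks through `v`. -/
def closedWalkLengths (G : Digraph V) (v : V) : Set ℕ := {k | G.HasWalk k v v}

/-- A closed walk of positive length is either a cycle or splits at a repeated node into two shorter
closed walks. -/
theorem imprimitivityIndex_dvd_of_hasWalk {v : V} {k : ℕ} (h : G.HasWalk k v v) :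
    G.imprimitivityIndex ∣ k := by
  induction k using Nat.strong_induction_on generalizing v with
  | _ k ih =>
    obtain ⟨l, hl, rfl⟩ := h
    obtain ⟨t, rfl⟩ := hl.exists_eq_cons
    by_cases ht : t.Nodup
    · cases t with
      | nil => simp [walkLength]
      | cons y t => exact Nat.setGcd_dvd_of_mem ⟨v, _, ⟨hl, by simp [walkLength], ht⟩, rfl⟩
    · obtain ⟨s, x, t, u, rfl⟩ := List.exists_append_of_not_nodup ht
      obtain ⟨h1, h2⟩ := IsWalk.exists_shortcut (s := v :: s) hl
      have h3 := ih _ (by simp [walkLength]) ⟨_, h1, rfl⟩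
      have h4 := ih _ (by simp [walkLength]; omega) ⟨_, h2, rfl⟩
      convert! dvd_add h3 h4 using 1
      simp [walkLength]; omega

theorem HasWalk.of_sccGraph {α : G.SCC} {k : ℕ} {a b : {v : V // G.sccId v = α}}
    (h : (G.sccGraph α).HasWalk k a b) : G.HasWalk k a.1 b.1 := by
  induction k generalizing a with
  | zero => rw [hasWalk_zero] at *; rw [h]
  | succ k ih =>
    obtain ⟨c, hc, h⟩ := hasWalk_succ.1 h
    exact hasWalk_succ.2 ⟨c.1, hc, ih h⟩

/-- A walk between nodes of one component cannot leave it: each node visited reaches `b`, which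
reaches `a` again. -/
theorem HasWalk.sccGraph {α : G.SCC} {k : ℕ} {a b : V} (h : G.HasWalk k a b)
    (ha : G.sccId a = α) (hb : G.sccId b = α) :
    (G.sccGraph α).HasWalk k ⟨a, ha⟩ ⟨b, hb⟩ := by
  induction k generalizing a with
  | zero => rw [hasWalk_zero] at *; simp [h]
  | succ k ih =>
    obtain ⟨c, hc, h⟩ := hasWalk_succ.1 h
    have hca : G.sccId c = α := by
      rw [← ha, sccId_eq_iff]
      exact ⟨h.reaches.trans (sccId_eq_iff.1 (hb.trans ha.symm)).1, .of_adj hc⟩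
    exact hasWalk_succ.2 ⟨⟨c, hca⟩, hc, ih h hca⟩

theorem imprimitivityIndex_sccGraph (v : V) :
    (G.sccGraph (G.sccId v)).imprimitivityIndex = Nat.setGcd (G.closedWalkLengths v) := by
  apply Nat.dvd_antisymm
  · exact Nat.dvd_setGcd_iff.2 fun k (hk : G.HasWalk k v v) =>
      imprimitivityIndex_dvd_of_hasWalk (hk.sccGraph rfl rfl)
  · refine Nat.dvd_setGcd_iff.2 ?_
    rintro _ ⟨⟨w, hw⟩, l, ⟨hl, -⟩, rfl⟩
    have h1 : G.HasWalk (walkLength l) w w := HasWalk.of_sccGraph ⟨l, hl, rfl⟩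
    obtain ⟨hwv, hvw⟩ := sccId_eq_iff.1 hw
    obtain ⟨r, hr⟩ := reaches_iff_exists_hasWalk.1 hwv
    obtain ⟨s, hs⟩ := reaches_iff_exists_hasWalk.1 hvw
    -- The round trip from `v` to `w` and back is a closed walk with or without the cycle at `w`;
    -- the two lengths differ by that of the cycle.
    have h2 : s + walkLength l + r ∈ G.closedWalkLengths v := (hs.add h1).add hr
    have h3 : s + r ∈ G.closedWalkLengths v := hs.add hr
    have h4 := Nat.dvd_sub (Nat.setGcd_dvd_of_mem h2) (Nat.setGcd_dvd_of_mem h3)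
    rwa [show s + walkLength l + r - (s + r) = walkLength l by omega] at h4

theorem isTrivialSCC_sccId_iff {v : V} :
    G.IsTrivialSCC (G.sccId v) ↔ ∀ k ∈ G.closedWalkLengths v, k = 0 := by
  constructor
  · rintro ⟨w, hw, hadj⟩ k hk
    obtain rfl := (hw v).1 rfl
    by_contra h0
    obtain ⟨r, rfl⟩ := Nat.exists_eq_succ_of_ne_zero h0
    obtain ⟨c, hc, h⟩ := hasWalk_succ.1 hk
    obtain rfl := (hw c).1 (sccId_eq_iff.2 ⟨h.reaches, .of_adj hc⟩)
    exact hadj hc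
  · intro h
    refine ⟨v, fun w => ⟨fun hw => ?_, fun hw => hw ▸ rfl⟩, fun hv =>
      one_ne_zero (h 1 (hasWalk_one.2 hv))⟩
    obtain ⟨hwv, hvw⟩ := sccId_eq_iff.1 hw
    obtain ⟨r, hr⟩ := reaches_iff_exists_hasWalk.1 hwv
    obtain ⟨s, hs⟩ := reaches_iff_exists_hasWalk.1 hvw
    have h0 := h _ (hs.add hr)
    obtain rfl : r = 0 := by omega
    exact hasWalk_zero.1 hr

theorem imprimitivityIndex_sccGraph_eq_zero_iff {v : V} :
    (G.sccGraph (G.sccId v)).imprimitivityIndex = 0 ↔ G.IsTrivialSCC (G.sccId v) := by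
  rw [imprimitivityIndex_sccGraph, Nat.setGcd_eq_zero_iff, isTrivialSCC_sccId_iff]
  rfl

/-- If the components on `p` are those of the nodes of `l`, then `eta p` is the gcd of the lengths
of all closed walks through nodes of `l`. -/
theorem eta_eq_setGcd {p : List G.SCC} {l : List V} (h : ∀ α, α ∈ p ↔ α ∈ l.map G.sccId) :
    G.eta p = Nat.setGcd (⋃ v ∈ l, G.closedWalkLengths v) := by
  apply Nat.dvd_antisymm
  · refine Nat.dvd_setGcd_iff.2 fun k hk => ?_
    simp only [Set.mem_iUnion] at hk
    obtain ⟨v, hv, hk⟩ := hk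
    -- A trivial component contributes only the length 0, which does not affect the gcd.
    by_cases ht : G.IsTrivialSCC (G.sccId v)
    · simp [isTrivialSCC_sccId_iff.1 ht k hk]
    · refine Dvd.dvd.trans (Nat.setGcd_dvd_of_mem
        ⟨G.sccId v, (h _).2 (List.mem_map_of_mem hv), ht, rfl⟩) ?_
      rw [imprimitivityIndex_sccGraph]
      exact Nat.setGcd_dvd_of_mem hk
  · refine Nat.dvd_setGcd_iff.2 fun d hd => ?_
    obtain ⟨α, hα, -, rfl⟩ := hd
    obtain ⟨v, hv, rfl⟩ := List.mem_map.1 ((h α).1 hα)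
    rw [imprimitivityIndex_sccGraph]
    exact Nat.setGcd_mono (Set.subset_biUnion_of_mem (u := fun v => G.closedWalkLengths v) hv)

theorem eta_ne_zero {p : List G.SCC} {α : G.SCC} (hα : α ∈ p) (ht : ¬ G.IsTrivialSCC α) :
    G.eta p ≠ 0 := by
  intro h0
  have h1 : G.eta p ∣ (G.sccGraph α).imprimitivityIndex :=
    Nat.setGcd_dvd_of_mem ⟨α, hα, ht, rfl⟩
  rw [h0, zero_dvd_iff] at h1
  obtain ⟨v, rfl⟩ := Quotient.exists_rep α
  exact ht (imprimitivityIndex_sccGraph_eq_zero_iff.1 h1)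

/-! ### Inserting and removing closed walks -/

theorem IsWalk.exists_insert {a b : V} {l : List V} (hl : G.IsWalk a b l) {k : ℕ}
    (hk : k ∈ AddSubmonoid.closure (⋃ v ∈ l, G.closedWalkLengths v)) :
    G.HasWalk (walkLength l + k) a b := by
  -- After one insertion the walk is no longer `l`, but the next closed walk is still based at a
  -- node of `l`; hence the generalization to walks `q` through all nodes of `l`.
  suffices H : ∀ q, G.IsWalk a b q → l ⊆ q →
      ∃ q', G.IsWalk a b q' ∧ l ⊆ q' ∧ walkLength q' = walkLength q + k by
    obtain ⟨q, hq, -, h⟩ := H l hl (List.Subset.refl l)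
    exact ⟨q, hq, h⟩
  induction hk using AddSubmonoid.closure_induction with
  | mem k hk =>
    intro q hq hlq
    simp only [Set.mem_iUnion] at hk
    obtain ⟨v, hv, c, hc, rfl⟩ := hk
    obtain ⟨s, u, rfl⟩ := List.append_of_mem (hlq hv)
    obtain ⟨h1, h2⟩ := isWalk_append_cons.1 hq
    obtain ⟨q1, hq1, hlen1, hs1, -⟩ := h1.append hc
    obtain ⟨q2, hq2, hlen2, hs2, hs3⟩ := hq1.append h2
    refine ⟨q2, hq2, fun x hx => ?_, ?_⟩
    · rcases List.mem_append.1 (hlq hx) with h | h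
      · exact hs2 (hs1 (by simp [h]))
      · exact hs3 h
    · rw [hlen2, hlen1]
      simp [walkLength]; omega
  | zero => exact fun q hq hlq => ⟨q, hq, hlq, rfl⟩
  | add x y _ _ hx hy =>
    intro q hq hlq
    obtain ⟨q1, hq1, hs1, h1⟩ := hx q hq hlq
    obtain ⟨q2, hq2, hs2, h2⟩ := hy q1 hq1 hs1
    exact ⟨q2, hq2, hs2, by omega⟩

/-- Every walk can be shortened to a path through the same components by removing closed walks
inside these components. -/
theorem IsWalk.exists_isPath {a b : V} {l : List V} (hl : G.IsWalk a b l) :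
    ∃ q, G.IsPath a b q ∧ (∀ α, α ∈ l.map G.sccId ↔ α ∈ q.map G.sccId) ∧
      ∃ k, walkLength l = walkLength q + k ∧
        ∀ d, (∀ v ∈ l, ∀ r ∈ G.closedWalkLengths v, d ∣ r) → d ∣ k := by
  induction hn : l.length using Nat.strong_induction_on generalizing l with
  | _ n ih =>
    by_cases hd : l.Nodup
    · exact ⟨l, ⟨hl, hd⟩, fun _ => Iff.rfl, 0, rfl, fun _ _ => dvd_zero _⟩
    · obtain ⟨s, x, t, u, rfl⟩ := List.exists_append_of_not_nodup hd
      obtain ⟨h1, h2⟩ := hl.exists_shortcut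
      obtain ⟨q, hq, hmem, k, hk, hdvd⟩ := ih _ (by simp at hn ⊢; omega) h1 rfl
      have ht : ∀ y ∈ t, G.sccId y = G.sccId x := fun y hy => h2.sccId_eq_of_mem (by simp [hy])
      refine ⟨q, hq, fun α => ?_, k + (t.length + 1), ?_, fun d hd => ?_⟩
      · rw [← hmem]
        simp only [List.map_append, List.map_cons, List.mem_append, List.mem_cons, List.mem_map]
        constructor
        · rintro (h | h | ⟨y, hy, rfl⟩ | h | h)
          · exact .inl h
          · exact .inr (.inl h)
          · exact .inr (.inl (ht y hy))
          · exact .inr (.inl h)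
          · exact .inr (.inr h)
        · rintro (h | h | h)
          · exact .inl h
          · exact .inr (.inl h)
          · exact .inr (.inr (.inr (.inr h)))
      · simp [walkLength] at hk ⊢; omega
      -- The shortened walk has no new nodes, so `d` remains a common divisor for it.
      · refine dvd_add (hdvd d fun v hv => hd v ?_) (hd x (by simp) _ ⟨_, h2, by simp [walkLength]⟩)
        simp only [List.mem_append, List.mem_cons] at hv ⊢
        tauto

/-! ### Projection to the condensation -/

/-- Condensation edges lie in the strict reachability order `R`. Since `R` is transitive, it relates
all pairs along the chain, which are therefore distinct. -/
theorem condensation_isChain_nodup {p : List G.SCC} (h : p.IsChain G.condensation.Adj) :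
    p.Nodup := by
  let R : G.SCC → G.SCC → Prop := fun α β =>
    α ≠ β ∧ ∀ u v, G.sccId u = α → G.sccId v = β → G.Reaches u v
  have hR : ∀ α β, G.condensation.Adj α β → R α β := by
    rintro α β ⟨hne, u, v, rfl, rfl, huv⟩
    exact ⟨hne, fun u' v' hu hv => ((sccId_eq_iff.1 hu).1.trans (.of_adj huv)).trans
      (sccId_eq_iff.1 hv).2⟩
  have : IsTrans G.SCC R := ⟨by
    rintro α β γ ⟨hne, h1⟩ ⟨-, h2⟩
    obtain ⟨v, rfl⟩ : ∃ v, G.sccId v = β := Quotient.exists_rep β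
    refine ⟨?_, fun u w hu hw => (h1 u v hu rfl).trans (h2 v w rfl hw)⟩
    rintro rfl
    obtain ⟨u, rfl⟩ : ∃ u, G.sccId u = α := Quotient.exists_rep α
    exact hne (sccId_eq_iff.2 ⟨h1 u v rfl rfl, h2 v u rfl rfl⟩)⟩
  exact (List.isChain_iff_pairwise.1 (h.imp hR)).imp And.left

theorem destutter'_sccId_aux [DecidableRel ((· ≠ ·) : G.SCC → G.SCC → Prop)] (t : List V) (a : V)
    (h : (a :: t).IsChain G.Adj) :
    ((t.map G.sccId).destutter' (· ≠ ·) (G.sccId a)).IsChain G.condensation.Adj ∧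
    ((t.map G.sccId).destutter' (· ≠ ·) (G.sccId a)).head? = some (G.sccId a) ∧
    ((t.map G.sccId).destutter' (· ≠ ·) (G.sccId a)).getLast? =
      ((a :: t).map G.sccId).getLast? ∧
    ∀ α, α ∈ (t.map G.sccId).destutter' (· ≠ ·) (G.sccId a) ↔ α ∈ (a :: t).map G.sccId := by
  induction t generalizing a with
  | nil => simp
  | cons b t ih =>
    rw [List.isChain_cons_cons] at h
    obtain ⟨h1, h2, h3, h4⟩ := ih b h.2
    simp only [List.map_cons]
    by_cases hab : G.sccId a = G.sccId b
    · rw [List.destutter'_cons_neg _ (by simpa using hab), hab]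
      refine ⟨h1, h2, ?_, fun α => ?_⟩
      · rw [h3]; simp [List.getLast?_cons]
      · rw [h4]; simp
    · rw [List.destutter'_cons_pos _ hab]
      refine ⟨List.isChain_cons.2 ⟨?_, h1⟩, rfl, ?_, fun α => ?_⟩
      · rw [h2]
        simp only [Option.mem_def, Option.some.injEq]
        rintro _ rfl
        exact ⟨hab, a, b, rfl, rfl, h.1⟩
      · rw [List.getLast?_cons, h3]; simp [List.getLast?_cons]
      · rw [List.mem_cons, h4]; simp

theorem IsWalk.destutter_mem_condPaths [DecidableRel ((· ≠ ·) : G.SCC → G.SCC → Prop)]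
    {a b : V} {l : List V} (h : G.IsWalk a b l) :
    (l.map G.sccId).destutter (· ≠ ·) ∈ G.condPaths a b := by
  obtain ⟨t, rfl⟩ := h.exists_eq_cons
  obtain ⟨h1, h2, h3, -⟩ := destutter'_sccId_aux t a h.1
  refine ⟨⟨h1, h2, ?_⟩, condensation_isChain_nodup h1⟩
  rw [List.map_cons, List.destutter_cons', h3, List.getLast?_map, h.2.2]
  rfl

theorem IsWalk.mem_destutter_iff [DecidableRel ((· ≠ ·) : G.SCC → G.SCC → Prop)]
    {a b : V} {l : List V} (h : G.IsWalk a b l) (α : G.SCC) :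
    α ∈ (l.map G.sccId).destutter (· ≠ ·) ↔ α ∈ l.map G.sccId := by
  obtain ⟨t, rfl⟩ := h.exists_eq_cons
  exact (destutter'_sccId_aux t a h.1).2.2.2 α

/-! ### Eventual periodicity of the walk lengths -/

theorem finite_condPaths [Finite V] (i j : V) : (G.condPaths i j).Finite := by
  have : Finite G.SCC := Quotient.finite _
  have := Fintype.ofFinite G.SCC
  exact (List.finite_length_le G.SCC (Fintype.card G.SCC)).subset
    fun p hp => hp.2.length_le_card

theorem etaBar_spec [Finite V] (G : Digraph V) (i j : V) :
    0 < G.etaBar i j ∧ ∀ p ∈ G.condPaths i j, G.eta p ≠ 0 → G.eta p ∣ G.etaBar i j := by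
  refine Nat.sInf_mem (s := {N | 0 < N ∧ ∀ p ∈ G.condPaths i j, G.eta p ≠ 0 → G.eta p ∣ N}) ?_
  have hf := finite_condPaths (G := G) i j
  -- Some positive common multiple exists, so the infimum is attained and is not the default 0.
  refine ⟨∏ p ∈ hf.toFinset, if G.eta p = 0 then 1 else G.eta p,
    Finset.prod_pos fun p _ => ?_, fun p hp h0 => ?_⟩
  · split_ifs <;> omega
  · have := Finset.dvd_prod_of_mem (fun p => if G.eta p = 0 then 1 else G.eta p)
      (hf.mem_toFinset.2 hp)
    simpa [h0] using this

theorem piBar_subset [Finite V] (i j : V) : G.piBar i j ⊆ Set.Iio (G.etaBar i j) := by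
  intro c hc
  simp only [piBar, Set.mem_iUnion] at hc
  obtain ⟨p, hp, a, ⟨⟨α, hα, ht⟩, l, -, rfl⟩, b, hb, rfl⟩ := hc
  have h0 := eta_ne_zero hα ht
  obtain ⟨e, he⟩ := (etaBar_spec G i j).2 p hp h0
  rw [he, Nat.mul_div_cancel_left _ (Nat.pos_of_ne_zero h0)] at hb
  have := Nat.mod_lt (walkLength l) (Nat.pos_of_ne_zero h0)
  rw [Set.mem_Iio, he]
  nlinarith

theorem HasWalk.mod_etaBar_mem_piBar [Fintype V] {i j : V} {k : ℕ} (h : G.HasWalk k i j)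
    (hk : Fintype.card V ≤ k) : k % G.etaBar i j ∈ G.piBar i j := by
  classical
  obtain ⟨l, hl, rfl⟩ := h
  obtain ⟨q, hq, hmem, d, hd, hdvd⟩ := hl.exists_isPath
  have hp := hq.1.destutter_mem_condPaths
  have hpm := hq.1.mem_destutter_iff
  set p := (q.map G.sccId).destutter (· ≠ ·) with hpdef
  have hpl : ∀ α, α ∈ p ↔ α ∈ l.map G.sccId := fun α => (hpm α).trans (hmem α).symm
  have hnt : ∃ α ∈ p, ¬ G.IsTrivialSCC α := by
    -- A walk with at least `card V` edges has more nodes than `V`; the repetition gives a closed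
    -- walk of positive length.
    have hnd : ¬ l.Nodup := fun hnd => by
      have h1 := hnd.length_le_card
      have h2 := List.length_pos_of_ne_nil hl.ne_nil
      unfold walkLength at hk
      omega
    obtain ⟨s, x, t, u, rfl⟩ := List.exists_append_of_not_nodup hnd
    refine ⟨G.sccId x, (hpl _).2 (List.mem_map_of_mem (by simp)), fun ht => ?_⟩
    have := isTrivialSCC_sccId_iff.1 ht _ ⟨_, hl.exists_shortcut.2, rfl⟩
    simp [walkLength] at this
  obtain ⟨α, hα, ht⟩ := hnt
  have h0 := Nat.pos_of_ne_zero (eta_ne_zero hα ht)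
  have hE := (etaBar_spec G i j).2 p hp h0.ne'
  have hE0 := (etaBar_spec G i j).1
  have hdvd' : G.eta p ∣ d := hdvd _ fun v hv r hr => by
    rw [eta_eq_setGcd hpl]
    exact Nat.setGcd_dvd_of_mem (Set.mem_biUnion hv hr)
  simp only [piBar, Set.mem_iUnion]
  -- Division by `eta p` of the residue modulo `etaBar`: the remainder is that of the path `q`, and
  -- the quotient is the shift `b`.
  refine ⟨p, hp, walkLength q % G.eta p, ⟨⟨α, hα, ht⟩, q, ⟨hq, ?_⟩, rfl⟩,
    (walkLength l % G.etaBar i j) / G.eta p, ?_, ?_⟩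
  · rw [hpdef]
  · exact Nat.div_lt_div_of_lt_of_dvd hE (Nat.mod_lt _ hE0)
  · have h1 : walkLength q % G.eta p = (walkLength l % G.etaBar i j) % G.eta p := by
      rw [Nat.mod_mod_of_dvd _ hE, hd, Nat.add_mod, Nat.mod_eq_zero_of_dvd hdvd', add_zero,
        Nat.mod_mod]
    rw [h1, Nat.mod_add_div']

theorem exists_hasWalk_of_mem_piBar [Finite V] {i j : V} {c : ℕ} (hc : c ∈ G.piBar i j) :
    ∃ K, ∀ k ≥ K, k % G.etaBar i j = c → G.HasWalk k i j := by
  classical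
  simp only [piBar, Set.mem_iUnion] at hc
  obtain ⟨p, hp, a, ⟨⟨α, hα, ht⟩, l, ⟨hl, hlp⟩, rfl⟩, b, hb, rfl⟩ := hc
  have h0 := eta_ne_zero hα ht
  have hE := (etaBar_spec G i j).2 p hp h0
  have hpl : ∀ α, α ∈ p ↔ α ∈ l.map G.sccId := by
    rw [← hlp]
    exact hl.1.mem_destutter_iff
  -- Every multiple of the gcd that is at least `K` is a sum of closed walk lengths.
  obtain ⟨K, hK⟩ := Nat.exists_mem_closure_of_ge (⋃ v ∈ l, G.closedWalkLengths v)
  refine ⟨walkLength l + K, fun k hk hkc => ?_⟩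
  obtain ⟨d, rfl⟩ := Nat.exists_eq_add_of_le (le_of_add_le_left hk)
  refine hl.1.exists_insert (hK d (by omega) ?_)
  rw [← eta_eq_setGcd hpl]
  have h1 : (walkLength l + d) % G.eta p = walkLength l % G.eta p := by
    rw [← Nat.mod_mod_of_dvd _ hE, hkc, Nat.add_mul_mod_self_right, Nat.mod_mod]
  have h2 : walkLength l + d ≡ walkLength l + 0 [MOD G.eta p] := h1
  exact (Nat.modEq_zero_iff_dvd).1 (Nat.ModEq.add_left_cancel' _ h2)

/-- For large `k` there is a walk of length `k` from `i` to `j` if and only if the residue of `k`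
modulo `etaBar i j` belongs to `piBar i j`. -/
theorem eventually_hasWalk_iff [Finite V] (G : Digraph V) (i j : V) :
    ∃ K, ∀ k ≥ K, (G.HasWalk k i j ↔ k % G.etaBar i j ∈ G.piBar i j) := by
  have := Fintype.ofFinite V
  have h : ∀ c, ∃ K, c ∈ G.piBar i j → ∀ k ≥ K, k % G.etaBar i j = c → G.HasWalk k i j := fun c => by
    by_cases hc : c ∈ G.piBar i j
    · obtain ⟨K, hK⟩ := exists_hasWalk_of_mem_piBar hc
      exact ⟨K, fun _ => hK⟩
    · exact ⟨0, fun h => absurd h hc⟩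
  choose K hK using h
  -- Only finitely many residues occur, and the sum dominates each of their thresholds.
  refine ⟨Fintype.card V + ∑ c ∈ Finset.range (G.etaBar i j), K c, fun k hk =>
    ⟨fun h => h.mod_etaBar_mem_piBar (by omega), fun h => hK _ h k ?_ rfl⟩⟩
  have := Finset.single_le_sum (f := K) (fun _ _ => Nat.zero_le _)
    (Finset.mem_range.2 (Nat.mod_lt k (etaBar_spec G i j).1))
  omega

end Digraph

/-! ### Sets of natural numbers that are eventually periodic -/

section EventuallyPeriodic

variable {S P : Set ℕ} {K e : ℕ}

theorem Set.infinite_iff_nonempty_of_eventually_mod_mem (he : 0 < e) (hP : P ⊆ Set.Iio e)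
    (h : ∀ k ≥ K, (k ∈ S ↔ k % e ∈ P)) : S.Infinite ↔ P.Nonempty := by
  constructor
  · intro hS
    obtain ⟨k, hk, hlt⟩ := hS.exists_gt K
    exact ⟨_, (h k hlt.le).1 hk⟩
  · rintro ⟨c, hc⟩
    refine Set.infinite_of_not_bddAbove fun ⟨b, hb⟩ => ?_
    -- An element of the class of `c` beyond both the threshold `K` and the supposed bound `b`.
    have hmem : c + e * (K + b + 1) ∈ S := by
      refine (h _ ?_).2 ?_
      · nlinarith
      · rw [Nat.add_mul_mod_self_left, Nat.mod_eq_of_lt (hP hc)]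
        exact hc
    have := hb hmem
    nlinarith

end EventuallyPeriodic

/-! ### Boolean control networks and their state transition digraphs -/

namespace BCN

variable {n m : ℕ} (B : BCN n m)

theorem delta_injective {k : ℕ} {a b : Fin k} (h : BoolMat.delta a = BoolMat.delta b) : a = b := by
  simpa [BoolMat.delta] using congrFun h a

theorem mulVec_stp_structureMatrix (r : Fin (2 ^ m)) (i : Fin (2 ^ n)) :
    BoolMat.mulVec (BoolMat.stp B.structureMatrix (BoolMat.delta r)) (BoolMat.delta i) =
      BoolMat.delta (BoolMat.vecIndex n (B.step (state i) ((BoolMat.vecIndex m).symm r))) := by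
  simpa [state] using B.structureMatrix_spec (state i) ((BoolMat.vecIndex m).symm r)

theorem stateDigraph_adj_iff {i j : Fin (2 ^ n)} :
    B.stateDigraph.Adj i j ↔ ∃ u, B.step (state i) u = state j := by
  simp only [stateDigraph, mulVec_stp_structureMatrix]
  constructor
  · rintro ⟨r, hr⟩
    exact ⟨(BoolMat.vecIndex m).symm r, by rw [delta_injective hr]; simp [state]⟩
  · rintro ⟨u, hu⟩
    exact ⟨BoolMat.vecIndex m u, by rw [Equiv.symm_apply_apply, hu]; simp [state]⟩

theorem oneStepMatrix_eq_true_iff {i j : Fin (2 ^ n)} :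
    B.oneStepMatrix j i = true ↔ B.stateDigraph.Adj i j := by
  simp only [oneStepMatrix, decide_eq_true_eq, stateDigraph]
  refine exists_congr fun r => ?_
  have h : BoolMat.stp B.structureMatrix (BoolMat.delta r) j i =
      BoolMat.mulVec (BoolMat.stp B.structureMatrix (BoolMat.delta r)) (BoolMat.delta i) j := by
    rw [Bool.eq_iff_iff]
    simp [BoolMat.mulVec, BoolMat.delta]
  rw [h, mulVec_stp_structureMatrix]
  constructor
  · intro hj
    rw [show j = _ by simpa only [BoolMat.delta, decide_eq_true_eq] using hj]
  · intro hj
    rw [← hj]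
    simp [BoolMat.delta]

theorem pow_oneStepMatrix_eq_true_iff {k : ℕ} {i j : Fin (2 ^ n)} :
    BoolMat.pow B.oneStepMatrix k j i = true ↔ B.stateDigraph.HasWalk k i j := by
  induction k generalizing i with
  | zero => simp [BoolMat.pow, Digraph.hasWalk_zero, eq_comm]
  | succ k ih =>
    simp only [BoolMat.pow, BoolMat.mul, decide_eq_true_eq, ih, oneStepMatrix_eq_true_iff,
      Digraph.hasWalk_succ]
    exact exists_congr fun c => and_comm

theorem exists_trajectory_eq_iff {k : ℕ} {i j : Fin (2 ^ n)} :
    (∃ u : ℕ → Fin m → Bool, B.trajectory (state i) u k = state j) ↔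
      B.stateDigraph.HasWalk k i j := by
  induction k generalizing j with
  | zero => simp [trajectory, Digraph.hasWalk_zero, state]
  | succ k ih =>
    simp only [trajectory, Digraph.hasWalk_succ', ← ih, stateDigraph_adj_iff]
    constructor
    · rintro ⟨u, hu⟩
      refine ⟨BoolMat.vecIndex n (B.trajectory (state i) u k), ⟨u, by simp [state]⟩, u k, ?_⟩
      simpa [state] using hu
    · rintro ⟨c, ⟨u, hu⟩, v, hv⟩
      -- The input at time `k` first influences the state at time `k + 1`.
      have hcongr : ∀ t ≤ k, B.trajectory (state i) (Function.update u k v) t =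
          B.trajectory (state i) u t := by
        intro t ht
        induction t with
        | zero => rfl
        | succ t iht =>
          rw [trajectory, trajectory, iht (by omega), Function.update_of_ne (by omega)]
      exact ⟨Function.update u k v, by rw [hcongr k le_rfl, hu, Function.update_self, hv]⟩

theorem mem_reachTimes_iff {k : ℕ} {i j : Fin (2 ^ n)} :
    k ∈ B.reachTimes i j ↔ 0 < k ∧ B.stateDigraph.HasWalk k i j :=
  and_congr_right fun _ => B.exists_trajectory_eq_iff

/-- Powers up to `N` suffice because a shortest walk of positive length has at most `N` edges, even
when it is closed. -/
theorem controllabilityMatrix_eq_true_iff {i j : Fin (2 ^ n)} :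
    B.controllabilityMatrix j i = true ↔ (B.reachTimes i j).Nonempty := by
  simp only [controllabilityMatrix, decide_eq_true_eq, pow_oneStepMatrix_eq_true_iff]
  constructor
  · rintro ⟨k, hk⟩
    exact ⟨_, B.mem_reachTimes_iff.2 ⟨Nat.succ_pos _, hk⟩⟩
  · rintro ⟨k, hk⟩
    obtain ⟨h0, hk⟩ := B.mem_reachTimes_iff.1 hk
    obtain ⟨r, hr, hle, hw⟩ := hk.exists_le_card h0
    rw [Fintype.card_fin] at hle
    exact ⟨⟨r - 1, by omega⟩, by simpa [Nat.sub_add_cancel hr] using hw⟩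

theorem infinite_reachTimes_iff (i j : Fin (2 ^ n)) :
    (B.reachTimes i j).Infinite ↔ (B.stateDigraph.piBar i j).Nonempty := by
  obtain ⟨K, hK⟩ := B.stateDigraph.eventually_hasWalk_iff i j
  -- The threshold `K + 1` forces `k > 0`, as time 0 never counts as reachable.
  refine Set.infinite_iff_nonempty_of_eventually_mod_mem (K := K + 1)
    (B.stateDigraph.etaBar_spec i j).1 (Digraph.piBar_subset i j) fun k hk => ?_
  rw [mem_reachTimes_iff, ← hK k (by omega)]
  exact and_iff_right (by omega)

theorem infinite_unreachTimes_iff (i j : Fin (2 ^ n)) :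
    (B.unreachTimes i j).Infinite ↔
      B.stateDigraph.piBar i j ≠ Set.Iio (B.stateDigraph.etaBar i j) := by
  obtain ⟨K, hK⟩ := B.stateDigraph.eventually_hasWalk_iff i j
  have hpos := (B.stateDigraph.etaBar_spec i j).1
  have hsub := Digraph.piBar_subset (G := B.stateDigraph) i j
  rw [Set.infinite_iff_nonempty_of_eventually_mod_mem (K := K + 1)
    (P := Set.Iio (B.stateDigraph.etaBar i j) \ B.stateDigraph.piBar i j) hpos Set.sdiff_subset,
    Set.sdiff_nonempty]
  · exact not_congr ⟨fun h => hsub.antisymm h, fun h => h.ge⟩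
  · intro k hk
    have h0 : 0 < k := by omega
    change 0 < k ∧ k ∉ B.reachTimes i j ↔ _
    rw [mem_reachTimes_iff, hK k (by omega), Set.mem_sdiff, Set.mem_Iio]
    simp [h0, Nat.mod_lt k hpos]

end BCN

/-! ### The four categories -/

theorem theorem1 {n m : ℕ} (B : BCN n m) (i j : Fin (2 ^ n)) :
    (B.categoryMatrix j i = 0 ↔ B.controllabilityMatrix j i = false) ∧
    (B.categoryMatrix j i = 1 ↔
      B.stateDigraph.piBar i j = ∅ ∧ B.controllabilityMatrix j i = true) ∧
    (B.categoryMatrix j i = 2 ↔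
      B.stateDigraph.piBar i j = Set.Iio (B.stateDigraph.etaBar i j)) ∧
    (B.categoryMatrix j i = 3 ↔
      B.stateDigraph.piBar i j ≠ ∅ ∧
      B.stateDigraph.piBar i j ≠ Set.Iio (B.stateDigraph.etaBar i j)) := by
  obtain ⟨h0, h1, h2, h3⟩ := B.categoryMatrix_eq_iff i j
  have hF := B.controllabilityMatrix_eq_true_iff (i := i) (j := j)
  have hI := B.infinite_reachTimes_iff i j
  have hU := B.infinite_unreachTimes_iff i j
  have hpos := (B.stateDigraph.etaBar_spec i j).1
  -- The full residue set is nonempty, so `piBar` cannot be both empty and full. This makes the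
  -- unreachable times infinite in the transient case and the reachable times infinite in the
  -- primitive case.
  have hne : (Set.Iio (B.stateDigraph.etaBar i j)).Nonempty := ⟨0, hpos⟩
  rw [Set.nonempty_iff_ne_empty] at hF hI hne
  refine ⟨?_, ?_, ?_, ?_⟩
  · rw [h0, BCN.IsUnreachable, ← Bool.not_eq_true, hF, not_not]
  · rw [h1, BCN.IsTransient, hF, hU, ← Set.not_infinite, hI, Set.nonempty_iff_ne_empty, not_not]
    refine ⟨fun h => ⟨h.2.1, h.1⟩, fun h => ⟨h.2, h.1, ?_⟩⟩
    rw [h.1]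
    exact hne.symm
  · rw [h2, BCN.IsPrimitive, ← Set.not_infinite, hU, hI, not_not]
    exact ⟨fun h => h.2, fun h => ⟨h ▸ hne, h⟩⟩
  · rw [h3, BCN.IsImprimitive, hU, hI]
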